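/- Fix $\alpha>0$. For each integer $N\ge 1$ let $M=M_N$ be the integer part of $N^{1+\alpha}$, and let $(\omega_t)_{t\ge0}=(\eta(\cdot,t),n_-(t),n_+(t))_{t\ge 0}$ be a continuous-time Markov process with state space $\{0,1\}^{\{1,\dots,N\}}\times\{0,\dots,M\}\times\{0,\dots,M\}$ and generator $$\mathbf L f(\omega)=\tfrac12\sum_{x=1}^{N-1}\big[f(\omega^{x,x+1})-f(\omega)\big]+c_N(\omega)\big[f(\omega^N)-f(\omega)\big]+c_1(\omega)\big[f(\omega^1)-f(\omega)\big].$$ Here $\omega^{x,x+1}$ is $\omega$ with $\eta(x)$ and $\eta(x+1)$ exchanged; $$c_N(\omega)=\tfrac12\Big(1-\frac{n_+}{M}\Big)\eta(N)+\tfrac12\,\frac{n_+}{M}\,(1-\eta(N)),\qquad c_1(\omega)=\tfrac12\Big(1-\frac{n_-}{M}\Big)\eta(1)+\tfrac12\,\frac{n_-}{M}\,(1-\eta(1));$$ in $\omega^N$ the occupation $\eta(N)$ is replaced by $1-\eta(N)$ and $n_+$ by $n_++1$ if $\eta(N)=1$, by $n_+-1$ if $\eta(N)=0$; and $\omega^1$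 is defined in the same way with the site $1$ and $n_-$. Set $\eta(0,t)=n_-(t)/M$, $\eta(N+1,t)=n_+(t)/M$, and, with $\varepsilon=1/N$, $$\rho^\varepsilon(x,t)=\mathbf E[\eta(x,t)]\quad(0\le x\le N+1),\qquad \rho^\varepsilon_-(t)=\rho^\varepsilon(0,t),\quad \rho^\varepsilon_+(t)=\rho^\varepsilon(N+1,t).$$ **Theorem (Global equilibrium limit).** Let $v_{0,\pm}\in[0,1]$ and suppose that the initial laws, otherwise arbitrary, satisfy $\rho^\varepsilon_\pm(0)=v_{0,\pm}$ for every $N\ge1$. Then for every $\alpha'>\alpha$, $r\in[0,1]$ and $t>0$, $$\lim_{N\to\infty}\rho^\varepsilon([Nr],N^{2+\alpha'}t)=\lim_{N\to\infty}\rho^\varepsilon_-(N^{2+\alpha'}t)=\lim_{N\to\infty}\rho^\varepsilon_+(N^{2+\alpha'}t)=\frac{v_{0,-}+v_{0,+}}2,$$ where $[Nr]$ is the integer part of $Nr$. -/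

import Mathlib

open MeasureTheory Filter Topology
open scoped NNReal

namespace SSEPReservoirs

/-- The channel `Λ_N = {1, …, N}`, for a positive integer `N`. -/
abbrev Channel (N : ℕ+) : Type := ↥(Finset.Icc 1 (N : ℕ))

/-- The leftmost site `1` of the channel. -/
def leftSite (N : ℕ+) : Channel N := ⟨1, Finset.mem_Icc.2 ⟨le_rfl, N.pos⟩⟩

/-- The rightmost site `N` of the channel. -/
def rightSite (N : ℕ+) : Channel N := ⟨(N : ℕ), Finset.mem_Icc.2 ⟨N.pos, le_rfl⟩⟩

/-- The state space `{0,1}^{Λ_N} × {0,…,M} × {0,…,M}`; a state is `(η, n₋, n₊)`, where `η` is the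
configuration of the channel (`true` means that the site is occupied) and `n₋`, `n₊` are the
numbers of particles in the left and in the right reservoir. -/
abbrev State (N : ℕ+) (M : ℕ) : Type := (Channel N → Bool) × Fin (M + 1) × Fin (M + 1)

variable {N : ℕ+} {M : ℕ}

/-- The number of particles (0 or 1) at a site of the channel. -/
def State.eta (ω : State N M) (x : Channel N) : ℝ := if ω.1 x then 1 else 0

/-- The density `n₋ / M` of the left reservoir. -/
noncomputable def State.densMinus (ω : State N M) : ℝ := (ω.2.1 : ℕ) / (M : ℝ)

/-- The density `n₊ / M` of the right reservoir. -/
noncomputable def State.densPlus (ω : State N M) : ℝ := (ω.2.2 : ℕ) / (M : ℝ)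

/-- The occupation variable on `{0, …, N+1}`: `η(x)` at the sites of the channel, `n₋ / M` at `0`
and `n₊ / M` at `N + 1` (and, as a convention, `0` beyond `N + 1`). -/
noncomputable def State.occ (ω : State N M) (x : ℕ) : ℝ :=
  if x = 0 then ω.densMinus
  else if x = N + 1 then ω.densPlus
  else if h : x ∈ Finset.Icc 1 (N : ℕ) then ω.eta ⟨x, h⟩ else 0

/-- `ω^{x,y}`: the occupations of the channel sites `x` and `y` are exchanged. -/
def State.exchange (ω : State N M) (x y : Channel N) : State N M :=
  (fun z => ω.1 (Equiv.swap x y z), ω.2)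

/-- A reservoir gains a particle. (At `n = M` nothing happens; the corresponding rate is zero.) -/
def gain (n : Fin (M + 1)) : Fin (M + 1) :=
  ⟨min (n + 1) M, Nat.lt_succ_of_le (min_le_right _ _)⟩

/-- A reservoir loses a particle. (At `n = 0` nothing happens; the corresponding rate is zero.) -/
def lose (n : Fin (M + 1)) : Fin (M + 1) :=
  ⟨n - 1, lt_of_le_of_lt (Nat.sub_le _ _) n.2⟩

/-- `ω^1`: if site `1` is occupied, its particle moves to the left reservoir; if it is empty, a
particle of the left reservoir moves there. -/
def State.flipLeft (ω : State N M) : State N M :=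
  (Function.update ω.1 (leftSite N) (!ω.1 (leftSite N)),
    if ω.1 (leftSite N) then gain ω.2.1 else lose ω.2.1, ω.2.2)

/-- `ω^N`: if site `N` is occupied, its particle moves to the right reservoir; if it is empty, a
particle of the right reservoir moves there. -/
def State.flipRight (ω : State N M) : State N M :=
  (Function.update ω.1 (rightSite N) (!ω.1 (rightSite N)), ω.2.1,
    if ω.1 (rightSite N) then gain ω.2.2 else lose ω.2.2)

/-- The rate `c_1(ω)` of exchange between site `1` and the left reservoir. -/
noncomputable def State.rateLeft (ω : State N M) : ℝ :=
  1 / 2 * (1 - ω.densMinus) * ω.eta (leftSite N) + 1 / 2 * ω.densMinus * (1 - ω.eta (leftSite N))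

/-- The rate `c_N(ω)` of exchange between site `N` and the right reservoir. -/
noncomputable def State.rateRight (ω : State N M) : ℝ :=
  1 / 2 * (1 - ω.densPlus) * ω.eta (rightSite N) + 1 / 2 * ω.densPlus * (1 - ω.eta (rightSite N))

/-- The generator
`L f(ω) = ½ ∑_{x=1}^{N-1} [f(ω^{x,x+1}) - f(ω)] + c_N(ω) [f(ω^N) - f(ω)] + c_1(ω) [f(ω^1) - f(ω)]`
acting on the functions on the (finite) state space. -/
noncomputable def generator (N : ℕ+) (M : ℕ) : (State N M → ℝ) →ₗ[ℝ] (State N M → ℝ) where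
  toFun f ω :=
    1 / 2 * (∑ p : Channel N × Channel N with (p.2 : ℕ) = (p.1 : ℕ) + 1,
      (f (ω.exchange p.1 p.2) - f ω))
    + ω.rateRight * (f ω.flipRight - f ω)
    + ω.rateLeft * (f ω.flipLeft - f ω)
  map_add' f g := by
    funext ω
    simp only [Pi.add_apply, add_sub_add_comm, Finset.sum_add_distrib]
    ring
  map_smul' c f := by
    funext ω
    simp only [Pi.smul_apply, smul_eq_mul, ← mul_sub, ← Finset.mul_sum, RingHom.id_apply]
    ring

/-- The semigroup `e^{tL}` generated by an operator `L` on the functions on a finite set. -/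
noncomputable def semigroup {S : Type*} [Fintype S] (L : (S → ℝ) →ₗ[ℝ] (S → ℝ)) (t : ℝ≥0) :
    (S → ℝ) →L[ℝ] (S → ℝ) :=
  NormedSpace.exp ((t : ℝ) • LinearMap.toContinuousLinearMap L)

/-- `X` is a (time-homogeneous, continuous-time) Markov process with generator `L` on the finite
state space `S`, under the probability measure `P`: for all times `s, t` and all functions `f`,
`E[f(X_{s+t}) | σ(X_u, u ≤ s)] = (e^{tL} f)(X_s)` almost surely. Its initial law is arbitrary. -/
structure IsMarkovProcess {S : Type*} [Fintype S] [mS : MeasurableSpace S]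
    (L : (S → ℝ) →ₗ[ℝ] (S → ℝ)) {Ω : Type*} [MeasurableSpace Ω] (P : Measure Ω)
    (X : ℝ≥0 → Ω → S) : Prop where
  measurable : ∀ t, Measurable (X t)
  markov : ∀ (s t : ℝ≥0) (f : S → ℝ),
    P[fun a => f (X (s + t) a) | ⨆ u ≤ s, mS.comap (X u)]
      =ᵐ[P] fun a => semigroup L t f (X s a)

/-- The size `M = N^{1+α}` of each reservoir (integer part). -/
noncomputable def reservoirSize (α : ℝ) (N : ℕ+) : ℕ := ⌊((N : ℕ) : ℝ) ^ (1 + α)⌋₊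

/-- The density `ρ(x, t) = E[η(x, t)]`, `x ∈ {0, …, N+1}`, of a process `X`; the left and the right
reservoir are `x = 0` and `x = N + 1`. -/
noncomputable def rho {Ω : Type*} [MeasurableSpace Ω] (P : Measure Ω)
    (X : ℝ≥0 → Ω → State N M) (x : ℕ) (t : ℝ≥0) : ℝ :=
  ∫ a, (X t a).occ x ∂P

end SSEPReservoirs

/-!
The densities `ρ(x, t)` solve a closed linear equation: the discrete heat equation on the path
`{0, …, N + 1}` with mass `M` at both ends and mass `1` in between. The mean of this equation with
respect to the masses is conserved, and since the reservoirs carry almost all of the mass it stays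
within `N / M` of the average of the two initial reservoir densities. By Cauchy–Schwarz along the
path, the variance is at most a constant of order `M N = N ^ (2 + α)` times the Dirichlet form, so
it decays exponentially on that time scale. At times of order `N ^ (2 + α')` the exponential beats
the initial variance, which is at most `2 M + N`.
-/

namespace SSEPReservoirs

theorem sum_mul_sq_sub_centerMass_le {ι : Type*} (s : Finset ι) {w : ι → ℝ} (hw : 0 < ∑ i ∈ s, w i)
    (a : ι → ℝ) (b : ℝ) :
    ∑ i ∈ s, w i * (a i - s.centerMass w a) ^ 2 ≤ ∑ i ∈ s, w i * (a i - b) ^ 2 := by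
  set c := s.centerMass w a with hc
  have hbarycenter : ∑ i ∈ s, w i * a i = (∑ i ∈ s, w i) * c := by
    simp only [hc, Finset.centerMass, smul_eq_mul, mul_inv_cancel_left₀ hw.ne']
  have hexpand : ∑ i ∈ s, w i * (a i - b) ^ 2
      = ∑ i ∈ s, w i * (a i - c) ^ 2 + (∑ i ∈ s, w i) * (c - b) ^ 2 := by
    have hterm : ∀ i, w i * (a i - b) ^ 2
        = w i * (a i - c) ^ 2 + (2 * (c - b) * (w i * a i) + w i * (b ^ 2 - c ^ 2)) :=
      fun i => by ring
    simp only [hterm, Finset.sum_add_distrib, ← Finset.mul_sum, ← Finset.sum_mul, hbarycenter]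
    ring
  rw [hexpand]
  exact le_add_of_nonneg_right (by positivity)

theorem le_mul_exp_of_hasDerivAt_le {f f' : ℝ → ℝ} {K : ℝ} (hf : ∀ t, HasDerivAt f (f' t) t)
    (hf' : ∀ t, f' t ≤ K * f t) {t : ℝ} (ht : 0 ≤ t) : f t ≤ f 0 * Real.exp (K * t) := by
  have hbound := le_gronwallBound_of_liminf_deriv_right_le (f := f) (f' := f') (K := K) (ε := 0)
    (fun s _ => (hf s).continuousAt.continuousWithinAt)
    (fun s _ _ hr => (hf s).hasDerivWithinAt.liminf_right_slope_le hr) le_rfl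
    (fun s _ => by simpa using hf' s) t ⟨ht, le_rfl⟩
  rwa [gronwallBound_ε0, sub_zero] at hbound

/-! ### The heat equation on a path -/

/-- The Laplacian of the path `{0, …, n}`, without flux through its two ends: the sum of
`a y - a x` over the neighbours `y` of `x`. -/
def pathLaplacian {E : Type*} [AddCommGroup E] (n : ℕ) (a : ℕ → E) (x : ℕ) : E :=
  (if x < n then a (x + 1) - a x else 0) + (if 0 < x then a (x - 1) - a x else 0)

theorem map_pathLaplacian {E F G : Type*} [AddCommGroup E] [AddCommGroup F] [FunLike G E F]
    [AddMonoidHomClass G E F] (ψ : G) (n : ℕ) (a : ℕ → E) (x : ℕ) :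
    ψ (pathLaplacian n a x) = pathLaplacian n (fun y => ψ (a y)) x := by
  simp only [pathLaplacian, map_add, apply_ite ψ, map_sub, map_zero]

theorem sum_mul_pathLaplacian (n : ℕ) (a b : ℕ → ℝ) :
    ∑ x ∈ Finset.range (n + 1), b x * pathLaplacian n a x
      = -∑ x ∈ Finset.range n, (b (x + 1) - b x) * (a (x + 1) - a x) := by
  have hright : ∑ x ∈ Finset.range (n + 1), b x * (if x < n then a (x + 1) - a x else 0)
      = ∑ x ∈ Finset.range n, b x * (a (x + 1) - a x) := by
    rw [Finset.sum_range_succ, if_neg (lt_irrefl n), mul_zero, add_zero]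
    exact Finset.sum_congr rfl fun x hx => by rw [if_pos (Finset.mem_range.1 hx)]
  have hleft : ∑ x ∈ Finset.range (n + 1), b x * (if 0 < x then a (x - 1) - a x else 0)
      = ∑ x ∈ Finset.range n, b (x + 1) * (a x - a (x + 1)) := by
    simp [Finset.sum_range_succ']
  simp only [pathLaplacian, mul_add, Finset.sum_add_distrib, hright, hleft]
  rw [← Finset.sum_add_distrib, ← Finset.sum_neg_distrib]
  exact Finset.sum_congr rfl fun x _ => by ring

theorem sum_pathLaplacian (n : ℕ) (a : ℕ → ℝ) :
    ∑ x ∈ Finset.range (n + 1), pathLaplacian n a x = 0 := by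
  simpa using sum_mul_pathLaplacian n a 1

theorem sq_sub_le_mul_sum_sq_sub_succ {n x : ℕ} (hx : x ≤ n) (a : ℕ → ℝ) :
    (a x - a 0) ^ 2 ≤ n * ∑ y ∈ Finset.range n, (a (y + 1) - a y) ^ 2 := by
  rw [← Finset.sum_range_sub a x]
  refine sq_sum_le_card_mul_sum_sq.trans ?_
  rw [Finset.card_range]
  gcongr

/-- The mean of a profile `a` on `{0, …, n}` with respect to the masses `m`. -/
noncomputable abbrev pathMean (n : ℕ) (m a : ℕ → ℝ) : ℝ :=
  (Finset.range (n + 1)).centerMass m a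

/-- The variance of a profile `a` on `{0, …, n}` with respect to the masses `m`, which are not
normalized. -/
noncomputable def pathVariance (n : ℕ) (m a : ℕ → ℝ) : ℝ :=
  ∑ x ∈ Finset.range (n + 1), m x * (a x - pathMean n m a) ^ 2

/-- `u` solves the heat equation `m ∂ₜu = κ Δu` on the path `{0, …, n}` with masses `m`. -/
def IsPathHeatFlow (n : ℕ) (m : ℕ → ℝ) (κ : ℝ) (u : ℝ → ℕ → ℝ) : Prop :=
  ∀ x ≤ n, ∀ t, HasDerivAt (fun s => u s x) (κ / m x * pathLaplacian n (u t) x) t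

section Path

variable {n : ℕ} {m : ℕ → ℝ} {κ : ℝ} {u : ℝ → ℕ → ℝ}

theorem sum_range_succ_pos (hm : ∀ x ≤ n, 0 < m x) : 0 < ∑ x ∈ Finset.range (n + 1), m x :=
  Finset.sum_pos (fun x hx => hm x (Finset.mem_range_succ_iff.1 hx)) Finset.nonempty_range_add_one

theorem pathMean_mem_Icc (hm : ∀ x ≤ n, 0 < m x) {a : ℕ → ℝ} {p q : ℝ}
    (ha : ∀ x ≤ n, a x ∈ Set.Icc p q) : pathMean n m a ∈ Set.Icc p q :=
  (convex_Icc p q).centerMass_mem (fun x hx => (hm x (Finset.mem_range_succ_iff.1 hx)).le)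
    (sum_range_succ_pos hm) fun x hx => ha x (Finset.mem_range_succ_iff.1 hx)

theorem pathVariance_le_mul_sum_sq_sub_succ (hm : ∀ x ≤ n, 0 < m x) (a : ℕ → ℝ) :
    pathVariance n m a ≤ (∑ x ∈ Finset.range (n + 1), m x) * n *
      ∑ x ∈ Finset.range n, (a (x + 1) - a x) ^ 2 := by
  calc pathVariance n m a ≤ ∑ x ∈ Finset.range (n + 1), m x * (a x - a 0) ^ 2 :=
        sum_mul_sq_sub_centerMass_le _ (sum_range_succ_pos hm) a (a 0)
    _ ≤ ∑ x ∈ Finset.range (n + 1), m x * (n * ∑ y ∈ Finset.range n, (a (y + 1) - a y) ^ 2) :=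
        Finset.sum_le_sum fun x hx => by
          have hxn := Finset.mem_range_succ_iff.1 hx
          exact mul_le_mul_of_nonneg_left (sq_sub_le_mul_sum_sq_sub_succ hxn a) (hm x hxn).le
    _ = _ := by rw [← Finset.sum_mul, mul_assoc]

theorem IsPathHeatFlow.pathMean_eq (hu : IsPathHeatFlow n m κ u) (hm : ∀ x ≤ n, 0 < m x)
    (t : ℝ) : pathMean n m (u t) = pathMean n m (u 0) := by
  have hderiv : ∀ s,
      HasDerivAt (fun s => ∑ x ∈ Finset.range (n + 1), m x * u s x) 0 s := fun s => by
    have hsum := HasDerivAt.fun_sum fun x (hx : x ∈ Finset.range (n + 1)) =>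
      (hu x (Finset.mem_range_succ_iff.1 hx) s).const_mul (m x)
    refine hsum.congr_deriv ?_
    rw [← mul_zero κ, ← sum_pathLaplacian n (u s), Finset.mul_sum]
    refine Finset.sum_congr rfl fun x hx => ?_
    rw [← mul_assoc, mul_div_cancel₀ _ (hm x (Finset.mem_range_succ_iff.1 hx)).ne']
  have hconst := is_const_of_deriv_eq_zero (fun s => (hderiv s).differentiableAt)
    (fun s => (hderiv s).deriv) t 0
  simp only [pathMean, Finset.centerMass, smul_eq_mul, hconst]

theorem IsPathHeatFlow.hasDerivAt_pathVariance (hu : IsPathHeatFlow n m κ u)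
    (hm : ∀ x ≤ n, 0 < m x) (t : ℝ) :
    HasDerivAt (fun s => pathVariance n m (u s))
      (-(2 * κ * ∑ x ∈ Finset.range n, (u t (x + 1) - u t x) ^ 2)) t := by
  simp only [pathVariance, hu.pathMean_eq hm]
  set c := pathMean n m (u 0)
  have hsum := HasDerivAt.fun_sum fun x (hx : x ∈ Finset.range (n + 1)) =>
    (((hu x (Finset.mem_range_succ_iff.1 hx) t).sub_const c).pow 2).const_mul (m x)
  refine hsum.congr_deriv ?_
  calc _ = ∑ x ∈ Finset.range (n + 1), 2 * κ * ((u t x - c) * pathLaplacian n (u t) x) :=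
        Finset.sum_congr rfl fun x hx => by
          have := (hm x (Finset.mem_range_succ_iff.1 hx)).ne'
          simp only [Nat.cast_ofNat, Nat.add_one_sub_one, pow_one]
          field_simp
    _ = _ := by
        rw [← Finset.mul_sum, sum_mul_pathLaplacian n (u t) fun x => u t x - c, mul_neg]
        simp only [sub_sub_sub_cancel_right, ← pow_two]

theorem IsPathHeatFlow.pathVariance_le (hu : IsPathHeatFlow n m κ u) (hm : ∀ x ≤ n, 0 < m x)
    (hκ : 0 ≤ κ) {t : ℝ} (ht : 0 ≤ t) :
    pathVariance n m (u t) ≤ pathVariance n m (u 0) *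
      Real.exp (-(2 * κ / ((∑ x ∈ Finset.range (n + 1), m x) * n)) * t) := by
  refine le_mul_exp_of_hasDerivAt_le (fun s => hu.hasDerivAt_pathVariance hm s) (fun s => ?_) ht
  have hZ := (sum_range_succ_pos hm).le
  have hgap : pathVariance n m (u s) / ((∑ x ∈ Finset.range (n + 1), m x) * n)
      ≤ ∑ x ∈ Finset.range n, (u s (x + 1) - u s x) ^ 2 :=
    div_le_of_le_mul₀ (by positivity) (by positivity)
      ((pathVariance_le_mul_sum_sq_sub_succ hm (u s)).trans_eq (mul_comm _ _))
  rw [neg_mul, neg_le_neg_iff, div_mul_eq_mul_div, mul_div_assoc]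
  gcongr

theorem mul_sq_sub_pathMean_le_pathVariance (hm : ∀ x ≤ n, 0 < m x) (a : ℕ → ℝ) {x : ℕ}
    (hx : x ≤ n) : m x * (a x - pathMean n m a) ^ 2 ≤ pathVariance n m a :=
  Finset.single_le_sum (f := fun y => m y * (a y - pathMean n m a) ^ 2)
    (fun y hy => mul_nonneg (hm y (Finset.mem_range_succ_iff.1 hy)).le (sq_nonneg _))
    (Finset.mem_range_succ_iff.2 hx)

theorem pathVariance_le_sum (hm : ∀ x ≤ n, 0 < m x) {a : ℕ → ℝ}
    (ha : ∀ x ≤ n, a x ∈ Set.Icc (0 : ℝ) 1) :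
    pathVariance n m a ≤ ∑ x ∈ Finset.range (n + 1), m x := by
  refine Finset.sum_le_sum fun x hx => ?_
  have hxn := Finset.mem_range_succ_iff.1 hx
  refine mul_le_of_le_one_right (hm x hxn).le ?_
  rw [sq_le_one_iff_abs_le_one]
  exact abs_sub_le_of_le_of_le (ha x hxn).1 (ha x hxn).2 (pathMean_mem_Icc hm ha).1
    (pathMean_mem_Icc hm ha).2 |>.trans_eq (sub_zero 1)

theorem IsPathHeatFlow.mul_sq_sub_pathMean_le (hu : IsPathHeatFlow n m κ u)
    (hm : ∀ x ≤ n, 0 < m x) (hκ : 0 ≤ κ) (h0 : ∀ x ≤ n, u 0 x ∈ Set.Icc (0 : ℝ) 1) {x : ℕ}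
    (hx : x ≤ n) {t : ℝ} (ht : 0 ≤ t) :
    m x * (u t x - pathMean n m (u 0)) ^ 2 ≤ (∑ y ∈ Finset.range (n + 1), m y) *
      Real.exp (-(2 * κ / ((∑ y ∈ Finset.range (n + 1), m y) * n)) * t) := by
  rw [← hu.pathMean_eq hm t]
  calc _ ≤ pathVariance n m (u t) := mul_sq_sub_pathMean_le_pathVariance hm (u t) hx
    _ ≤ _ := hu.pathVariance_le hm hκ ht
    _ ≤ _ := by gcongr; exact pathVariance_le_sum hm h0

end Path

/-! ### The generator acting on the occupation variables -/

/-- The number of particles that `x ∈ {0, …, N + 1}` can hold: `M` for the reservoirs, `1` for the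
sites of the channel. These are the masses for which the densities solve a heat equation. -/
def capacity (N M : ℕ) (x : ℕ) : ℝ := if x = 0 ∨ x = N + 1 then M else 1

theorem one_le_capacity {M : ℕ} (hM : 0 < M) (N x : ℕ) : 1 ≤ capacity N M x := by
  unfold capacity
  split_ifs
  · exact_mod_cast hM
  · exact le_rfl

theorem sum_capacity_mul (N M : ℕ) (a : ℕ → ℝ) :
    ∑ x ∈ Finset.range (N + 2), capacity N M x * a x
      = M * (a 0 + a (N + 1)) + ∑ x ∈ Finset.range N, a (x + 1) := by
  have hchannel : ∑ x ∈ Finset.range N, capacity N M (x + 1) * a (x + 1)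
      = ∑ x ∈ Finset.range N, a (x + 1) :=
    Finset.sum_congr rfl fun x hx => by simp [capacity, (Finset.mem_range.1 hx).ne]
  rw [Finset.sum_range_succ, Finset.sum_range_succ', hchannel]
  simp only [capacity, true_or, or_true, if_true]
  ring

theorem sum_capacity (N M : ℕ) : ∑ x ∈ Finset.range (N + 2), capacity N M x = 2 * M + N := by
  have h := sum_capacity_mul N M 1
  simp only [Pi.one_apply, mul_one, Finset.sum_const, Finset.card_range, nsmul_eq_mul] at h
  rw [h]
  ring

theorem abs_pathMean_capacity_sub_le {N M : ℕ} (hM : 0 < M) {a : ℕ → ℝ}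
    (ha : ∀ x ≤ N + 1, a x ∈ Set.Icc (0 : ℝ) 1) :
    |pathMean (N + 1) (capacity N M) a - (a 0 + a (N + 1)) / 2| ≤ N / M := by
  set average := (a 0 + a (N + 1)) / 2 with haverage
  have hM' : (0 : ℝ) < M := by exact_mod_cast hM
  have hdiff : pathMean (N + 1) (capacity N M) a - average
      = (∑ x ∈ Finset.range N, (a (x + 1) - average)) / (2 * M + N) := by
    simp only [pathMean, Finset.centerMass, smul_eq_mul, sum_capacity, sum_capacity_mul,
      Finset.sum_sub_distrib, Finset.sum_const, Finset.card_range, nsmul_eq_mul]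
    rw [haverage]
    field_simp
    ring
  have hterm : ∀ x ∈ Finset.range N, |a (x + 1) - average| ≤ 1 := fun x hx => by
    have hleft := ha 0 (Nat.zero_le _)
    have hright := ha (N + 1) le_rfl
    have hsite := ha (x + 1) (by have := Finset.mem_range.1 hx; omega)
    rw [haverage, abs_le]
    constructor <;> linarith [hleft.1, hleft.2, hright.1, hright.2, hsite.1, hsite.2]
  have hsum : |∑ x ∈ Finset.range N, (a (x + 1) - average)| ≤ N :=
    (Finset.abs_sum_le_sum_abs _ _).trans <| (Finset.sum_le_card_nsmul _ _ 1 hterm).trans_eq <| by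
      simp
  have hZ : (M : ℝ) ≤ 2 * M + N := by linarith [Nat.cast_nonneg (α := ℝ) N]
  rw [hdiff, abs_div, abs_of_pos (hM'.trans_le hZ)]
  gcongr

section Generator

variable {N : ℕ+} {M : ℕ}

theorem State.occ_zero (ω : State N M) : ω.occ 0 = ω.densMinus := by simp [State.occ]

theorem State.occ_last (ω : State N M) : ω.occ (N + 1) = ω.densPlus := by simp [State.occ]

theorem State.occ_channel (ω : State N M) (x : Channel N) : ω.occ x = ω.eta x := by
  have hx := Finset.mem_Icc.1 x.2
  rw [State.occ, if_neg (by omega), if_neg (by omega), dif_pos x.2]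

theorem natCast_fin_div_mem_Icc (n : Fin (M + 1)) : ((n : ℕ) : ℝ) / M ∈ Set.Icc (0 : ℝ) 1 :=
  ⟨by positivity, div_le_one_of_le₀ (by exact_mod_cast Nat.lt_succ_iff.1 n.2) (by positivity)⟩

theorem State.occ_mem_Icc (ω : State N M) (x : ℕ) : ω.occ x ∈ Set.Icc (0 : ℝ) 1 := by
  unfold State.occ State.eta
  split_ifs
  · exact natCast_fin_div_mem_Icc _
  · exact natCast_fin_div_mem_Icc _
  all_goals simp

theorem State.eta_exchange_sub (ω : State N M) (x y z : Channel N) :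
    (ω.exchange x y).eta z - ω.eta z
      = (if x = z then ω.eta y - ω.eta z else 0) + (if y = z then ω.eta x - ω.eta z else 0) := by
  have hswap : (ω.exchange x y).eta z = ω.eta (Equiv.swap x y z) := rfl
  rw [hswap]
  by_cases hx : x = z
  · subst hx
    by_cases hy : y = x <;> simp [hy]
  · by_cases hy : y = z
    · subst hy
      simp [hx]
    · simp [hx, hy, Equiv.swap_apply_of_ne_of_ne (Ne.symm hx) (Ne.symm hy)]

theorem sum_bonds_ite_fst (z : Channel N) (g : ℕ → ℝ) :
    ∑ p : Channel N × Channel N with (p.2 : ℕ) = (p.1 : ℕ) + 1, (if p.1 = z then g p.2 else 0)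
      = if (z : ℕ) < N then g (z + 1) else 0 := by
  have hiff : (z : ℕ) + 1 ∈ Finset.Icc 1 (N : ℕ) ↔ (z : ℕ) < N := by
    rw [Finset.mem_Icc]
    omega
  calc _ = ∑ y : Channel N, if (y : ℕ) = z + 1 then g y else 0 := by
        rw [← Finset.sum_filter, Finset.filter_comm, Finset.sum_filter, Finset.sum_filter,
          Fintype.sum_prod_type_right]
        simp only [Finset.sum_ite_eq', Finset.mem_univ, if_true]
    _ = ∑ y ∈ Finset.Icc 1 (N : ℕ), if y = z + 1 then g y else 0 :=
        Finset.sum_coe_sort (Finset.Icc 1 (N : ℕ)) fun y => if y = z + 1 then g y else 0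
    _ = _ := by rw [Finset.sum_ite_eq', if_congr hiff rfl rfl]

theorem sum_bonds_ite_snd (z : Channel N) (g : ℕ → ℝ) :
    ∑ p : Channel N × Channel N with (p.2 : ℕ) = (p.1 : ℕ) + 1, (if p.2 = z then g p.1 else 0)
      = if 1 < (z : ℕ) then g (z - 1) else 0 := by
  have hz := Finset.mem_Icc.1 z.2
  have hiff : (z : ℕ) - 1 ∈ Finset.Icc 1 (N : ℕ) ↔ 1 < (z : ℕ) := by
    rw [Finset.mem_Icc]
    omega
  have hpred : ∀ x : ℕ, (z : ℕ) = x + 1 ↔ x = z - 1 := fun x => by omega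
  calc _ = ∑ x : Channel N, if (x : ℕ) = z - 1 then g x else 0 := by
        rw [← Finset.sum_filter, Finset.filter_comm, Finset.sum_filter, Finset.sum_filter,
          Fintype.sum_prod_type]
        simp only [Finset.sum_ite_eq', Finset.mem_univ, if_true, hpred]
    _ = ∑ x ∈ Finset.Icc 1 (N : ℕ), if x = z - 1 then g x else 0 :=
        Finset.sum_coe_sort (Finset.Icc 1 (N : ℕ)) fun x => if x = z - 1 then g x else 0
    _ = _ := by rw [Finset.sum_ite_eq', if_congr hiff rfl rfl]

theorem sum_eta_exchange_sub (ω : State N M) (z : Channel N) :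
    ∑ p : Channel N × Channel N with (p.2 : ℕ) = (p.1 : ℕ) + 1,
        ((ω.exchange p.1 p.2).eta z - ω.eta z)
      = (if (z : ℕ) < N then ω.occ (z + 1) - ω.occ z else 0)
        + (if 1 < (z : ℕ) then ω.occ (z - 1) - ω.occ z else 0) := by
  rw [← sum_bonds_ite_fst z fun y => ω.occ y - ω.occ z,
    ← sum_bonds_ite_snd z fun x => ω.occ x - ω.occ z, ← Finset.sum_add_distrib]
  simp only [State.eta_exchange_sub, State.occ_channel]

-- As `η ^ 2 = η`, the products of `η` and the reservoir density in rate times jump cancel, both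
-- here and in the jump of the reservoir density: this is why the equation for the densities closes.
theorem exchangeRate_mul_occupation_jump (b : Bool) (d : ℝ) :
    (1 / 2 * (1 - d) * (if b then 1 else 0) + 1 / 2 * d * (1 - if b then 1 else 0))
        * ((if !b then 1 else 0) - if b then 1 else 0)
      = 1 / 2 * (d - if b then 1 else 0) := by
  cases b
  · simp only [Bool.false_eq_true, if_false, Bool.not_false, if_true]
    ring
  · simp only [if_true, Bool.not_true, Bool.false_eq_true, if_false]
    ring

theorem gain_of_lt {n : Fin (M + 1)} (hn : (n : ℕ) < M) : (gain n : ℕ) = n + 1 :=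
  min_eq_left hn

theorem exchangeRate_mul_density_jump (hM : 0 < M) (b : Bool) (n : Fin (M + 1)) :
    M * ((1 / 2 * (1 - (n : ℕ) / (M : ℝ)) * (if b then 1 else 0)
          + 1 / 2 * ((n : ℕ) / (M : ℝ)) * (1 - if b then 1 else 0))
        * (((if b then gain n else lose n : Fin (M + 1)) : ℕ) / (M : ℝ) - (n : ℕ) / (M : ℝ)))
      = 1 / 2 * ((if b then 1 else 0) - (n : ℕ) / (M : ℝ)) := by
  have hM' : (M : ℝ) ≠ 0 := by positivity
  cases b
  · rcases Nat.eq_zero_or_pos (n : ℕ) with hempty | hpos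
    · simp [hempty]
    · have hlose : ((lose n : ℕ) : ℝ) = (n : ℕ) - 1 := Nat.cast_pred hpos
      simp only [Bool.false_eq_true, if_false, hlose]
      field_simp
      ring
  · rcases (Nat.lt_succ_iff.1 n.2).eq_or_lt with hfull | hlt
    · simp [hfull, hM']
    · simp only [if_true, gain_of_lt hlt, Nat.cast_add_one]
      field_simp
      ring

theorem State.rateLeft_mul_eta_flipLeft_sub (ω : State N M) (z : Channel N) :
    ω.rateLeft * (ω.flipLeft.eta z - ω.eta z)
      = if (z : ℕ) = 1 then 1 / 2 * (ω.occ (z - 1) - ω.occ z) else 0 := by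
  by_cases hz : z = leftSite N
  · have hjump := exchangeRate_mul_occupation_jump (ω.1 (leftSite N)) ω.densMinus
    rw [hz, if_pos (by rfl), State.occ_channel, show (leftSite N : ℕ) - 1 = 0 from rfl,
      State.occ_zero]
    simpa [State.rateLeft, State.eta, State.flipLeft] using hjump
  · have hne : (z : ℕ) ≠ 1 := fun h => hz (Subtype.ext h)
    simp [State.eta, State.flipLeft, hz, hne]

theorem State.rateRight_mul_eta_flipRight_sub (ω : State N M) (z : Channel N) :
    ω.rateRight * (ω.flipRight.eta z - ω.eta z)
      = if (z : ℕ) = N then 1 / 2 * (ω.occ (z + 1) - ω.occ z) else 0 := by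
  by_cases hz : z = rightSite N
  · have hjump := exchangeRate_mul_occupation_jump (ω.1 (rightSite N)) ω.densPlus
    rw [hz, if_pos (by rfl), State.occ_channel, show (rightSite N : ℕ) + 1 = N + 1 from rfl,
      State.occ_last]
    simpa [State.rateRight, State.eta, State.flipRight] using hjump
  · have hne : (z : ℕ) ≠ N := fun h => hz (Subtype.ext h)
    simp [State.eta, State.flipRight, hz, hne]

theorem generator_apply (f : State N M → ℝ) (ω : State N M) :
    generator N M f ω =
      1 / 2 * (∑ p : Channel N × Channel N with (p.2 : ℕ) = (p.1 : ℕ) + 1,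
        (f (ω.exchange p.1 p.2) - f ω))
      + ω.rateRight * (f ω.flipRight - f ω) + ω.rateLeft * (f ω.flipLeft - f ω) := rfl

theorem generator_occ_channel (ω : State N M) (z : Channel N) :
    generator N M (fun ω => ω.occ z) ω
      = 1 / 2 * ((ω.occ (z + 1) - ω.occ z) + (ω.occ (z - 1) - ω.occ z)) := by
  have hz := Finset.mem_Icc.1 z.2
  simp only [State.occ_channel, generator_apply, sum_eta_exchange_sub,
    State.rateLeft_mul_eta_flipLeft_sub, State.rateRight_mul_eta_flipRight_sub]
  split_ifs <;> first | omega | ring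

theorem mul_generator_occ_zero (hM : 0 < M) (ω : State N M) :
    M * generator N M (fun ω => ω.occ 0) ω = 1 / 2 * (ω.occ 1 - ω.occ 0) := by
  have hsite : ω.occ 1 = ω.eta (leftSite N) := ω.occ_channel (leftSite N)
  have hexchange : ∀ x y, (ω.exchange x y).densMinus = ω.densMinus := fun _ _ => rfl
  have hflipRight : ω.flipRight.densMinus = ω.densMinus := rfl
  simp only [generator_apply, State.occ_zero, hexchange, hflipRight, sub_self,
    Finset.sum_const_zero, mul_zero, zero_add, hsite]
  exact exchangeRate_mul_density_jump hM (ω.1 (leftSite N)) ω.2.1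

theorem mul_generator_occ_last (hM : 0 < M) (ω : State N M) :
    M * generator N M (fun ω => ω.occ (N + 1)) ω = 1 / 2 * (ω.occ N - ω.occ (N + 1)) := by
  have hsite : ω.occ N = ω.eta (rightSite N) := ω.occ_channel (rightSite N)
  have hexchange : ∀ x y, (ω.exchange x y).densPlus = ω.densPlus := fun _ _ => rfl
  have hflipLeft : ω.flipLeft.densPlus = ω.densPlus := rfl
  simp only [generator_apply, State.occ_last, hexchange, hflipLeft, sub_self,
    Finset.sum_const_zero, mul_zero, zero_add, add_zero, hsite]
  exact exchangeRate_mul_density_jump hM (ω.1 (rightSite N)) ω.2.2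

theorem capacity_mul_generator_occ (hM : 0 < M) (ω : State N M) {x : ℕ} (hx : x ≤ N + 1) :
    capacity N M x * generator N M (fun ω => ω.occ x) ω
      = 1 / 2 * pathLaplacian (N + 1) ω.occ x := by
  rcases Nat.eq_zero_or_pos x with rfl | hpos
  · simpa [capacity, pathLaplacian] using mul_generator_occ_zero hM ω
  rcases hx.eq_or_lt with rfl | hlt
  · simpa [capacity, pathLaplacian] using mul_generator_occ_last hM ω
  · have hchannel := generator_occ_channel ω ⟨x, Finset.mem_Icc.2 ⟨hpos, Nat.lt_succ_iff.1 hlt⟩⟩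
    simpa [capacity, pathLaplacian, hpos, hpos.ne', hlt, hlt.ne] using hchannel

end Generator

/-! ### Densities of the process -/

theorem hasDerivAt_clm_exp_smul_apply {𝕜 E F : Type*} [RCLike 𝕜] [NormedAddCommGroup E]
    [NormedSpace 𝕜 E] [CompleteSpace E] [NormedAddCommGroup F] [NormedSpace 𝕜 F]
    (A : E →L[𝕜] E) (φ : E →L[𝕜] F) (f : E) (t : 𝕜) :
    HasDerivAt (fun s : 𝕜 => φ (NormedSpace.exp (s • A) f))
      (φ (NormedSpace.exp (t • A) (A f))) t := by
  have hexp := (hasDerivAt_exp_smul_const A t).clm_apply (hasDerivAt_const t f)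
  refine (φ.hasFDerivAt.comp_hasDerivAt t hexp).congr_deriv ?_
  simp

section Expectation

variable {S : Type*} [MeasurableSpace S] {Ω : Type*} [MeasurableSpace Ω]

theorem integrable_comp_of_finite [Finite S] [MeasurableSingletonClass S] (P : Measure Ω)
    [IsFiniteMeasure P] {Y : Ω → S} (hY : Measurable Y) (f : S → ℝ) :
    Integrable (fun a => f (Y a)) P :=
  Integrable.comp_measurable .of_finite hY

/-- The expectation `f ↦ E[f(Y)]` of the functions of a random variable `Y` with finitely many
values, as a functional to be composed with the semigroup. -/
noncomputable def expectation [Finite S] [MeasurableSingletonClass S] (P : Measure Ω)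
    [IsFiniteMeasure P] {Y : Ω → S} (hY : Measurable Y) : (S → ℝ) →L[ℝ] ℝ :=
  LinearMap.toContinuousLinearMap
    { toFun := fun f => ∫ a, f (Y a) ∂P
      map_add' := fun f g =>
        integral_add (integrable_comp_of_finite P hY f) (integrable_comp_of_finite P hY g)
      map_smul' := fun c _ => integral_const_mul c _ }

theorem IsMarkovProcess.integral_comp_eq [Fintype S] {L : (S → ℝ) →ₗ[ℝ] (S → ℝ)}
    {P : Measure Ω} [IsFiniteMeasure P] {X : ℝ≥0 → Ω → S} (hX : IsMarkovProcess L P X) (t : ℝ≥0)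
    (f : S → ℝ) : ∫ a, f (X t a) ∂P = ∫ a, semigroup L t f (X 0 a) ∂P := by
  rw [← integral_congr_ae (hX.markov 0 t f), zero_add]
  exact (integral_condExp (iSup₂_le fun u _ => (hX.measurable u).comap_le)).symm

end Expectation

section Density

variable {N : ℕ+} {M : ℕ} {Ω : Type*} [MeasurableSpace Ω] {P : Measure Ω} [IsProbabilityMeasure P]
  {X : ℝ≥0 → Ω → State N M}

theorem rho_mem_Icc {t : ℝ≥0} (hX : Measurable (X t)) (x : ℕ) :
    rho P X x t ∈ Set.Icc (0 : ℝ) 1 := by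
  have hint := integrable_comp_of_finite P hX fun ω => ω.occ x
  refine ⟨integral_nonneg fun a => (State.occ_mem_Icc _ x).1, ?_⟩
  simpa [rho] using integral_mono hint (integrable_const 1) fun a => (State.occ_mem_Icc _ x).2

theorem generator_occ_eq_smul_pathLaplacian (hM : 0 < M) {x : ℕ} (hx : x ≤ N + 1) :
    generator N M (fun ω => ω.occ x)
      = (1 / 2 / capacity N M x) • pathLaplacian (N + 1) (fun y (ω : State N M) => ω.occ y) x := by
  funext ω
  have hmass : capacity N M x ≠ 0 := (zero_lt_one.trans_le (one_le_capacity hM N x)).ne'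
  have heval : pathLaplacian (N + 1) (fun y (ω : State N M) => ω.occ y) x ω
      = pathLaplacian (N + 1) ω.occ x :=
    map_pathLaplacian (Pi.evalAddMonoidHom (fun _ : State N M => ℝ) ω) (N + 1)
      (fun y (ω : State N M) => ω.occ y) x
  rw [Pi.smul_apply, smul_eq_mul, heval, div_mul_eq_mul_div, eq_div_iff hmass, mul_comm,
    capacity_mul_generator_occ hM ω hx]

theorem isPathHeatFlow_exp_generator (hM : 0 < M) (φ : (State N M → ℝ) →L[ℝ] ℝ) :
    IsPathHeatFlow (N + 1) (capacity N M) (1 / 2) fun t x =>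
      φ (NormedSpace.exp (t • LinearMap.toContinuousLinearMap (generator N M))
        fun ω => ω.occ x) := by
  intro x hx t
  set A := LinearMap.toContinuousLinearMap (generator N M)
  refine (hasDerivAt_clm_exp_smul_apply A φ (fun ω => ω.occ x) t).congr_deriv ?_
  change φ.comp (NormedSpace.exp (t • A)) (generator N M fun ω => ω.occ x) = _
  rw [generator_occ_eq_smul_pathLaplacian hM hx, map_smul, map_pathLaplacian, smul_eq_mul]
  rfl

theorem sq_rho_sub_pathMean_le (hM : 0 < M) (hX : IsMarkovProcess (generator N M) P X) {x : ℕ}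
    (hx : x ≤ N + 1) (t : ℝ≥0) :
    (rho P X x t - pathMean (N + 1) (capacity N M) fun y => rho P X y 0) ^ 2
      ≤ (2 * M + N) * Real.exp (-(t / ((2 * M + N) * (N + 1)))) := by
  have hone_le := one_le_capacity hM N
  have hflow := isPathHeatFlow_exp_generator hM (expectation P (hX.measurable 0))
  set u : ℝ → ℕ → ℝ := fun t x => expectation P (hX.measurable 0)
    (NormedSpace.exp (t • LinearMap.toContinuousLinearMap (generator N M)) fun ω => ω.occ x)
  have hrho : ∀ (y : ℕ) (s : ℝ≥0), rho P X y s = u s y := fun y s =>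
    hX.integral_comp_eq s fun ω => ω.occ y
  have hinit : (fun y => rho P X y 0) = u 0 := funext fun y => by rw [hrho, NNReal.coe_zero]
  have hdecay := hflow.mul_sq_sub_pathMean_le (fun y _ => zero_lt_one.trans_le (hone_le y))
    one_half_pos.le (fun y _ => congrFun hinit y ▸ rho_mem_Icc (hX.measurable 0) y) hx t.2
  rw [hrho, hinit]
  refine (le_mul_of_one_le_left (sq_nonneg _) (hone_le x)).trans (hdecay.trans_eq ?_)
  rw [sum_capacity, mul_one_div_cancel two_ne_zero, neg_mul, one_div_mul_eq_div]
  push_cast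
  rfl

theorem abs_rho_sub_average_le (hM : 0 < M) (hX : IsMarkovProcess (generator N M) P X) {x : ℕ}
    (hx : x ≤ N + 1) (t : ℝ≥0) :
    |rho P X x t - (rho P X 0 0 + rho P X (N + 1) 0) / 2|
      ≤ √((2 * M + N) * Real.exp (-(t / ((2 * M + N) * (N + 1))))) + N / M :=
  (abs_sub_le _ (pathMean (N + 1) (capacity N M) fun y => rho P X y 0) _).trans <| add_le_add
    (Real.abs_le_sqrt (sq_rho_sub_pathMean_le hM hX hx t))
    (abs_pathMean_capacity_sub_le hM fun y _ => rho_mem_Icc (hX.measurable 0) y)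

end Density

/-! ### Asymptotics -/

theorem tendsto_pnat_cast_atTop : Tendsto (fun N : ℕ+ => ((N : ℕ) : ℝ)) atTop atTop :=
  tendsto_natCast_atTop_atTop.comp tendsto_PNat_val_atTop_atTop

section Asymptotics

variable {α α' t : ℝ}

theorem one_le_cast_rpow (hα : 0 ≤ 1 + α) (N : ℕ+) : (1 : ℝ) ≤ ((N : ℕ) : ℝ) ^ (1 + α) :=
  Real.one_le_rpow (by exact_mod_cast N.pos) hα

theorem reservoirSize_pos (hα : 0 ≤ 1 + α) (N : ℕ+) : 0 < reservoirSize α N :=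
  Nat.floor_pos.2 (one_le_cast_rpow hα N)

theorem rpow_le_two_mul_reservoirSize (hα : 0 ≤ 1 + α) (N : ℕ+) :
    ((N : ℕ) : ℝ) ^ (1 + α) ≤ 2 * reservoirSize α N := by
  have hone_le : (1 : ℝ) ≤ reservoirSize α N := by exact_mod_cast reservoirSize_pos hα N
  have hlt : ((N : ℕ) : ℝ) ^ (1 + α) < reservoirSize α N + 1 := Nat.lt_floor_add_one _
  linarith

theorem tendsto_div_reservoirSize (hα : 0 < α) :
    Tendsto (fun N : ℕ+ => ((N : ℕ) : ℝ) / reservoirSize α N) atTop (𝓝 0) := by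
  have hlim := ((tendsto_rpow_neg_atTop hα).comp tendsto_pnat_cast_atTop).const_mul 2
  rw [mul_zero] at hlim
  refine squeeze_zero (fun N => by positivity) (fun N => ?_) hlim
  have hN : (0 : ℝ) < (N : ℕ) := by exact_mod_cast N.pos
  have hM : (0 : ℝ) < reservoirSize α N := by exact_mod_cast reservoirSize_pos (by linarith) N
  rw [div_le_iff₀ hM]
  calc ((N : ℕ) : ℝ) = ((N : ℕ) : ℝ) ^ (-α) * ((N : ℕ) : ℝ) ^ (1 + α) := by
        rw [← Real.rpow_add hN, neg_add_cancel_comm_assoc, Real.rpow_one]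
    _ ≤ ((N : ℕ) : ℝ) ^ (-α) * (2 * reservoirSize α N) := by
        gcongr
        exact rpow_le_two_mul_reservoirSize (by linarith) N
    _ = 2 * ((N : ℕ) : ℝ) ^ (-α) * reservoirSize α N := by ring

theorem two_mul_reservoirSize_add_le (hα : 0 ≤ α) (N : ℕ+) :
    2 * (reservoirSize α N : ℝ) + (N : ℕ) ≤ 3 * ((N : ℕ) : ℝ) ^ (1 + α) := by
  have hM : (reservoirSize α N : ℝ) ≤ ((N : ℕ) : ℝ) ^ (1 + α) := Nat.floor_le (by positivity)
  have hN : ((N : ℕ) : ℝ) ≤ ((N : ℕ) : ℝ) ^ (1 + α) :=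
    Real.self_le_rpow_of_one_le (by exact_mod_cast N.pos) (by linarith)
  linarith

theorem mul_exp_neg_div_le {L Z : ℝ} (hL : 1 ≤ L) (hZ : 0 < Z) (hZL : Z ≤ 3 * L ^ (1 + α))
    (ht : 0 ≤ t) :
    Z * Real.exp (-(L ^ (2 + α') * t / (Z * (L + 1))))
      ≤ 3 * (L ^ (1 + α) * Real.exp (-(t / 6) * L ^ (α' - α))) := by
  have hL0 : 0 < L := zero_lt_one.trans_le hL
  have hsplit : L ^ (2 + α') = L ^ (α' - α) * (L ^ (1 + α) * L) := by
    rw [← Real.rpow_add_one hL0.ne', ← Real.rpow_add hL0]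
    ring_nf
  have hrate : t / 6 * L ^ (α' - α) ≤ L ^ (2 + α') * t / (Z * (L + 1)) := by
    rw [le_div_iff₀ (by positivity)]
    calc t / 6 * L ^ (α' - α) * (Z * (L + 1))
        ≤ t / 6 * L ^ (α' - α) * (3 * L ^ (1 + α) * (2 * L)) := by
          gcongr
          linarith
      _ = L ^ (2 + α') * t := by
          rw [hsplit]
          ring
  rw [← mul_assoc, neg_mul]
  gcongr

theorem tendsto_rpow_mul_exp_neg_mul_rpow {s β b : ℝ} (hβ : 0 < β) (hb : 0 < b) :
    Tendsto (fun L : ℝ => L ^ s * Real.exp (-b * L ^ β)) atTop (𝓝 0) := by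
  refine ((tendsto_rpow_mul_exp_neg_mul_atTop_nhds_zero (s / β) b hb).comp
    (tendsto_rpow_atTop hβ)).congr' ?_
  filter_upwards [eventually_ge_atTop 0] with L hL
  rw [Function.comp_apply, ← Real.rpow_mul hL, mul_div_cancel₀ s hβ.ne']

theorem tendsto_relaxation_bound (hα : 0 ≤ α) (hα' : α < α') (ht : 0 < t) :
    Tendsto (fun N : ℕ+ => (2 * (reservoirSize α N : ℝ) + (N : ℕ)) *
      Real.exp (-(((N : ℕ) : ℝ) ^ (2 + α') * t /
        ((2 * (reservoirSize α N : ℝ) + (N : ℕ)) * ((N : ℕ) + 1))))) atTop (𝓝 0) := by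
  have hlim := ((tendsto_rpow_mul_exp_neg_mul_rpow (s := 1 + α) (sub_pos.2 hα')
    (show 0 < t / 6 by positivity)).comp tendsto_pnat_cast_atTop).const_mul 3
  rw [mul_zero] at hlim
  refine squeeze_zero (fun N => by positivity) (fun N => ?_) hlim
  have hN : (1 : ℝ) ≤ (N : ℕ) := by exact_mod_cast N.pos
  exact mul_exp_neg_div_le hN (by positivity) (two_mul_reservoirSize_add_le hα N) ht.le

end Asymptotics

end SSEPReservoirs

open SSEPReservoirs in
theorem mainTheorem5_general {α α' : ℝ} (hα : 0 < α) (hα' : α < α') {vMinus vPlus : ℝ}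
    {Ω : ℕ+ → Type*} [∀ N, MeasurableSpace (Ω N)]
    {P : ∀ N : ℕ+, Measure (Ω N)} [∀ N, IsProbabilityMeasure (P N)]
    {X : ∀ N : ℕ+, ℝ≥0 → Ω N → State N (reservoirSize α N)}
    (hX : ∀ N : ℕ+, IsMarkovProcess (generator N (reservoirSize α N)) (P N) (X N))
    (hInitMinus : Tendsto (fun N : ℕ+ => rho (P N) (X N) 0 0) atTop (𝓝 vMinus))
    (hInitPlus : Tendsto (fun N : ℕ+ => rho (P N) (X N) (N + 1) 0) atTop (𝓝 vPlus))
    {t : ℝ≥0} (ht : 0 < t) {x : ℕ+ → ℕ} (hx : ∀ N, x N ≤ N + 1) :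
    Tendsto (fun N : ℕ+ => rho (P N) (X N) (x N) (((N : ℕ) : ℝ≥0) ^ (2 + α') * t)) atTop
      (𝓝 ((vMinus + vPlus) / 2)) := by
  have herror := ((tendsto_relaxation_bound hα.le hα' (NNReal.coe_pos.2 ht)).sqrt).add
    (tendsto_div_reservoirSize hα)
  rw [Real.sqrt_zero, add_zero] at herror
  have hdiff : Tendsto (fun N : ℕ+ => rho (P N) (X N) (x N) (((N : ℕ) : ℝ≥0) ^ (2 + α') * t)
      - (rho (P N) (X N) 0 0 + rho (P N) (X N) (N + 1) 0) / 2) atTop (𝓝 0) := by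
    refine squeeze_zero_norm (fun N => ?_) herror
    simpa using abs_rho_sub_average_le (reservoirSize_pos (by linarith) N) (hX N) (hx N)
      (((N : ℕ) : ℝ≥0) ^ (2 + α') * t)
  simpa using hdiff.add ((hInitMinus.add hInitPlus).div_const 2)

theorem mainTheorem5 (α : ℝ) (hα : 0 < α) (vMinus vPlus : ℝ)
    (hvMinus : vMinus ∈ Set.Icc (0 : ℝ) 1) (hvPlus : vPlus ∈ Set.Icc (0 : ℝ) 1)
    {Ω : ℕ+ → Type*} [∀ N, MeasurableSpace (Ω N)]
    (P : ∀ N : ℕ+, Measure (Ω N)) [∀ N, IsProbabilityMeasure (P N)]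
    (X : ∀ N : ℕ+, ℝ≥0 → Ω N → SSEPReservoirs.State N (SSEPReservoirs.reservoirSize α N))
    (hX : ∀ N : ℕ+, SSEPReservoirs.IsMarkovProcess
      (SSEPReservoirs.generator N (SSEPReservoirs.reservoirSize α N)) (P N) (X N))
    (hInitMinus : ∀ N : ℕ+, SSEPReservoirs.rho (P N) (X N) 0 0 = vMinus)
    (hInitPlus : ∀ N : ℕ+, SSEPReservoirs.rho (P N) (X N) (N + 1) 0 = vPlus)
    (α' : ℝ) (hα' : α < α') (t : ℝ≥0) (ht : 0 < t) :
    (∀ r ∈ Set.Icc (0 : ℝ) 1,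
      Tendsto (fun N : ℕ+ => SSEPReservoirs.rho (P N) (X N) ⌊((N : ℕ) : ℝ) * r⌋₊
        (((N : ℕ) : ℝ≥0) ^ (2 + α') * t)) atTop (𝓝 ((vMinus + vPlus) / 2))) ∧
    Tendsto (fun N : ℕ+ => SSEPReservoirs.rho (P N) (X N) 0
      (((N : ℕ) : ℝ≥0) ^ (2 + α') * t)) atTop (𝓝 ((vMinus + vPlus) / 2)) ∧
    Tendsto (fun N : ℕ+ => SSEPReservoirs.rho (P N) (X N) (N + 1)
      (((N : ℕ) : ℝ≥0) ^ (2 + α') * t)) atTop (𝓝 ((vMinus + vPlus) / 2)) := by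
  have hlim {x : ℕ+ → ℕ} := mainTheorem5_general hα hα' hX
    (tendsto_const_nhds.congr fun N => (hInitMinus N).symm)
    (tendsto_const_nhds.congr fun N => (hInitPlus N).symm) ht (x := x)
  refine ⟨fun r hr => hlim fun N => ?_, hlim fun N => Nat.zero_le _, hlim fun N => le_rfl⟩
  exact (Nat.floor_le_of_le (mul_le_of_le_one_right (Nat.cast_nonneg _) hr.2)).trans (Nat.le_succ _)
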